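/- Let $d\in\mathbb{N}$, let $g\in L^2(\mathbb{R}^d)$ be non-zero, and let $\Lambda=A\mathbb{Z}^{2d}\subseteq\mathbb{R}^{2d}$ be a lattice, where $A$ is an invertible real $2d\times 2d$ matrix, with volume $\mathrm{vol}(\Lambda)=|\det A|$. For $z=(x,\xi)\in\mathbb{R}^{d}\times\mathbb{R}^d$ let $\pi(z)f(t)=e^{2\pi i\xi\cdot t}f(t-x)$ be the time-frequency shift on $L^2(\mathbb{R}^d)$, and for $M\subseteq\mathbb{R}^{2d}$ let $\mathcal{G}(g,M)=(\pi(\mu)g)_{\mu\in M}$. Let $\Lambda^\circ=\mathcal{I}(A^T)^{-1}\mathbb{Z}^{2d}$ be the adjoint lattice, where $\mathcal{I}=\begin{pmatrix}0&I_d\\-I_d&0\end{pmatrix}$. The system $\mathcal{G}(g,\Lambda)$ is called a tight frame with frame bound $a>0$ if $$\sum_{\lambda\in\Lambda}|\langle f,\pi(\lambda)g\rangle|^2=a\|f\|_{L^2}^2\qquad\text{for all } f\in L^2(\mathbb{R}^d),$$ and a tight frame if this holds for some $a>0$. Then $\mathcal{G}(g,\Lambda)$ is a tight frame if and only if $\mathcal{G}(g,\Lambda^\circ)$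 is an orthogonal system, that is, $\langle\pi(\mu)g,\pi(\nu)g\rangle=0$ for all distinct $\mu,\nu\in\Lambda^\circ$. In this case the frame bound is $a=\mathrm{vol}(\Lambda)^{-1}\|g\|_{L^2}^2$. -/

import Mathlib

open MeasureTheory

open scoped Matrix ENNReal

namespace Gabor

noncomputable section

/-- Index set of the `2d` coordinates of phase space: `Sum.inl` for position, `Sum.inr` for
frequency. -/
abbrev Idx (d : ℕ) : Type := Fin d ⊕ Fin d

/-- Phase space `ℝ^{2d}`, whose points are `z = (x, ξ)`. -/
abbrev PhaseSpace (d : ℕ) : Type := Idx d → ℝ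

/-- The position part `x` of `z = (x, ξ)`. -/
def pos {d : ℕ} (z : PhaseSpace d) : EuclideanSpace ℝ (Fin d) :=
  WithLp.toLp 2 fun i => z (Sum.inl i)

/-- The frequency part `ξ` of `z = (x, ξ)`. -/
def freq {d : ℕ} (z : PhaseSpace d) : EuclideanSpace ℝ (Fin d) :=
  WithLp.toLp 2 fun i => z (Sum.inr i)

/-- The Hilbert space `L²(ℝ^d)` of complex-valued functions. -/
abbrev L2 (d : ℕ) : Type := Lp ℂ 2 (volume : Measure (EuclideanSpace ℝ (Fin d)))

/-- The function `t ↦ e^{2πi ξ·t} f(t - x)`, where `z = (x, ξ)`. -/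
def shiftFun {d : ℕ} (z : PhaseSpace d) (f : EuclideanSpace ℝ (Fin d) → ℂ)
    (t : EuclideanSpace ℝ (Fin d)) : ℂ :=
  Complex.exp (2 * Real.pi * Complex.I * (inner ℝ (freq z) t : ℝ)) * f (t - pos z)

theorem memLp_shiftFun {d : ℕ} (z : PhaseSpace d) {f : EuclideanSpace ℝ (Fin d) → ℂ}
    (hf : MemLp f 2 volume) : MemLp (shiftFun z f) 2 volume := by
  have h1 : MemLp (fun t => f (t - pos z)) 2 volume :=
    hf.comp_measurePreserving (measurePreserving_sub_right volume (pos z))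
  have hc : Continuous fun t : EuclideanSpace ℝ (Fin d) =>
      Complex.exp (2 * Real.pi * Complex.I * (inner ℝ (freq z) t : ℝ)) := by fun_prop
  refine h1.congr_norm (hc.aestronglyMeasurable.mul h1.1) (Filter.Eventually.of_forall fun t => ?_)
  have he : 2 * (Real.pi : ℂ) * Complex.I * ((inner ℝ (freq z) t : ℝ) : ℂ)
      = ((2 * Real.pi * inner ℝ (freq z) t : ℝ) : ℂ) * Complex.I := by
    push_cast; ring
  simp only [shiftFun, norm_mul, he, Complex.norm_exp_ofReal_mul_I, one_mul]

/-- The time-frequency shift `π(z)` on `L²(ℝ^d)`. -/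
def tfShift {d : ℕ} (z : PhaseSpace d) (f : L2 d) : L2 d :=
  (memLp_shiftFun z (Lp.memLp f)).toLp (shiftFun z f)

/-- The lattice `Λ = A ℤ^{2d}`; it is only used for invertible `A`. -/
def lattice {d : ℕ} (A : Matrix (Idx d) (Idx d) ℝ) : Set (PhaseSpace d) :=
  Set.range fun k : Idx d → ℤ => A *ᵥ fun i => (k i : ℝ)

/-- The volume `|det A|` of the lattice `A ℤ^{2d}`. -/
def vol {d : ℕ} (A : Matrix (Idx d) (Idx d) ℝ) : ℝ := |A.det|

/-- The standard symplectic matrix, with blocks `0, I_d; -I_d, 0`. -/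
def sympl (d : ℕ) : Matrix (Idx d) (Idx d) ℝ := Matrix.fromBlocks 0 1 (-1) 0

/-- The adjoint lattice `Λ° = 𝓘 (Aᵀ)⁻¹ ℤ^{2d}` of `Λ = A ℤ^{2d}`, the image under the standard
symplectic matrix of the dual lattice `Λ^⊥ = (Aᵀ)⁻¹ ℤ^{2d}`. -/
def adjointLattice {d : ℕ} (A : Matrix (Idx d) (Idx d) ℝ) : Set (PhaseSpace d) :=
  (fun z => sympl d *ᵥ z) '' lattice (Aᵀ)⁻¹

/-- The Gabor system `G(g, Λ) = (π(λ) g)_{λ ∈ Λ}`. -/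
def system {d : ℕ} (g : L2 d) (Λ : Set (PhaseSpace d)) : Λ → L2 d := fun l => tfShift (l : PhaseSpace d) g

/-- `φ` is a frame with frame bounds `a, b`: both are positive and
`a ‖f‖² ≤ ∑ᵢ |⟨f, φᵢ⟩|² ≤ b ‖f‖²` for all `f`, the series being convergent. -/
def IsFrameWith {ι H : Type*} [NormedAddCommGroup H] [InnerProductSpace ℂ H]
    (φ : ι → H) (a b : ℝ) : Prop :=
  0 < a ∧ 0 < b ∧ ∀ f : H, Summable (fun i => ‖inner ℂ (φ i) f‖ ^ 2) ∧
    a * ‖f‖ ^ 2 ≤ ∑' i, ‖inner ℂ (φ i) f‖ ^ 2 ∧ ∑' i, ‖inner ℂ (φ i) f‖ ^ 2 ≤ b * ‖f‖ ^ 2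

/-- `φ` is a tight frame with frame bound `a`. -/
def IsTightFrameWith {ι H : Type*} [NormedAddCommGroup H] [InnerProductSpace ℂ H]
    (φ : ι → H) (a : ℝ) : Prop :=
  IsFrameWith φ a a

/-- `φ` is a tight frame: its two frame bounds can be chosen equal. -/
def IsTightFrame {ι H : Type*} [NormedAddCommGroup H] [InnerProductSpace ℂ H]
    (φ : ι → H) : Prop :=
  ∃ a : ℝ, IsTightFrameWith φ a

/-- `φ` is an orthogonal system: distinct members are orthogonal. -/
def IsOrthogonalSystem {ι H : Type*} [NormedAddCommGroup H] [InnerProductSpace ℂ H]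
    (φ : ι → H) : Prop :=
  ∀ i j : ι, i ≠ j → inner ℂ (φ i) (φ j) = 0

end

end Gabor

/-! The link between the two lattices is the Fourier transform of the spectrogram: integrating `|⟨f,
π(z)g⟩|²` against a character of phase space gives `⟨f, π(w)f⟩⟨π(w)g, g⟩`, where `w` is the
frequency of the character rotated by the symplectic matrix
(`integral_norm_sq_inner_tfShift_mul_phase`, from Plancherel and Fubini). In the coordinates `z =
Ay`, the characters that are periodic under integer shifts correspond exactly to the points `w` of
the adjoint lattice, and the change of variables contributes `vol(Λ)⁻¹`.

By covariance, the periodization of the spectrogram at `y` is the frame sum of `π(-Ay)f`. If the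
frame is tight, this is constant in `y`, because time-frequency shifts are isometric; so the nonzero
Fourier coefficients vanish. For each `w` some `f` has `⟨f, π(w)f⟩ ≠ 0`, which forces `⟨π(w)g, g⟩ =
0`. The total integral gives the bound.

Conversely, orthogonality kills the nonzero coefficients, and uniqueness of Fourier coefficients of
finite measures on the torus makes the periodization equal to its mean almost everywhere, hence on a
dense set. The value at `y = 0` is then recovered: the upper bound by lower semicontinuity of the
frame sum (`frameSum_le`), the lower bound from this upper bound and strong continuity of the shifts
(`le_frameSum`). -/

namespace Gabor

open scoped FourierTransform SchwartzMap ComplexConjugate ContDiff Topology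

/-! ### Plancherel for the Fourier integral -/

section Plancherel

variable {E : Type*} [NormedAddCommGroup E] [InnerProductSpace ℝ E] [FiniteDimensional ℝ E]
  [MeasurableSpace E] [BorelSpace E]

theorem continuous_fourier_of_integrable {h : E → ℂ} (h1 : Integrable h) : Continuous (𝓕 h) :=
  VectorFourier.fourierIntegral_continuous Real.continuous_fourierChar
    (L := innerₗ E) continuous_inner h1

/-- The `L²`-Fourier transform agrees with the Fourier integral on `L¹ ∩ L²`. -/
theorem coeFn_fourier_toLp {h : E → ℂ} (h1 : Integrable h) (h2 : MemLp h 2) :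
    (𝓕 (h2.toLp h) : Lp ℂ 2 (volume : Measure E)) =ᵐ[volume] 𝓕 h := by
  -- Compactly supported smooth test functions are Schwartz, so the `L²` transform may be tested as
  -- a tempered distribution; its defining duality matches the self-adjointness of the Fourier
  -- integral on `L¹`.
  refine ae_eq_of_integral_contDiff_smul_eq
    ((Lp.memLp _).locallyIntegrable (by norm_num))
    (continuous_fourier_of_integrable h1).locallyIntegrable fun φ hφ hc => ?_
  have hc' : HasCompactSupport (fun x => (φ x : ℂ)) := hc.comp_left (g := fun r : ℝ => (r : ℂ)) rfl
  let ψ : 𝓢(E, ℂ) := hc'.toSchwartzMap (Complex.ofRealCLM.contDiff.comp hφ)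
  have hψ : ∀ x, ψ x = (φ x : ℂ) := fun x => rfl
  have key := DFunLike.congr_fun (Lp.fourier_toTemperedDistribution_eq (h2.toLp h)) ψ
  rw [TemperedDistribution.fourier_apply, Lp.toTemperedDistribution_apply,
    Lp.toTemperedDistribution_apply] at key
  have e1 : ∀ x, φ x • (𝓕 h) x = (𝓕 h x) • ψ x := fun x => by
    rw [hψ, Complex.real_smul, smul_eq_mul, mul_comm]
  simp_rw [e1]
  have e2 : ∀ x, φ x • (𝓕 (h2.toLp h) : Lp ℂ 2 (volume : Measure E)) x
      = ψ x • (𝓕 (h2.toLp h) : Lp ℂ 2 (volume : Measure E)) x := fun x => by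
    rw [hψ, Complex.real_smul, smul_eq_mul]
  simp_rw [e2]
  rw [← key]
  have flip := VectorFourier.integral_fourierIntegral_smul_eq_flip (μ := (volume : Measure E))
    (ν := (volume : Measure E)) (L := innerₗ E) (f := h) (g := ψ)
    Real.continuous_fourierChar continuous_inner h1 ψ.integrable
  refine Eq.trans ?_ flip.symm
  rw [flip_innerₗ]
  refine integral_congr_ae ?_
  filter_upwards [h2.coeFn_toLp] with x hx
  rw [hx, smul_eq_mul, smul_eq_mul, mul_comm, SchwartzMap.fourier_coe]
  rfl

theorem memLp_fourier {h : E → ℂ} (h1 : Integrable h) (h2 : MemLp h 2) : MemLp (𝓕 h) 2 :=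
  (memLp_congr_ae (coeFn_fourier_toLp h1 h2)).1 (Lp.memLp _)

/-- **Plancherel's theorem** for the Fourier integral on `L¹ ∩ L²`. -/
theorem integral_conj_fourier_mul_fourier {h k : E → ℂ} (h1 : Integrable h) (h2 : MemLp h 2)
    (k1 : Integrable k) (k2 : MemLp k 2) :
    ∫ ξ, conj (𝓕 h ξ) * 𝓕 k ξ = ∫ t, conj (h t) * k t := by
  have key := Lp.inner_fourier_eq (h2.toLp h) (k2.toLp k)
  rw [L2.inner_def, L2.inner_def] at key
  calc
    _ = _ := integral_congr_ae ?_
    _ = _ := key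
    _ = _ := integral_congr_ae ?_
  · filter_upwards [coeFn_fourier_toLp h1 h2, coeFn_fourier_toLp k1 k2] with x hx hy
    rw [hx, hy, RCLike.inner_apply, mul_comm]
  · filter_upwards [h2.coeFn_toLp, k2.coeFn_toLp] with x hx hy
    rw [hx, hy, RCLike.inner_apply, mul_comm]

end Plancherel

/-! ### Periodization and Fourier coefficients on the torus -/

section Periodization

variable {ι : Type*}

/-- The half-open unit box with lower corner `a`. -/
def unitBox (a : ι → ℝ) : Set (ι → ℝ) := {x | ∀ i, x i ∈ Set.Ioc (a i) (a i + 1)}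

theorem unitBox_eq_pi (a : ι → ℝ) :
    unitBox a = Set.univ.pi fun i => Set.Ioc (a i) (a i + 1) := by
  ext x; simp [unitBox]

/-- The projection of `ℝ^ι` onto the torus. -/
def toTorus (x : ι → ℝ) : UnitAddTorus ι := fun i => (x i : UnitAddCircle)

theorem measurable_toTorus : Measurable (toTorus : (ι → ℝ) → UnitAddTorus ι) :=
  measurable_pi_lambda _ fun i => AddCircle.measurable_mk'.comp (measurable_pi_apply i)

theorem toTorus_add_intCast (x : ι → ℝ) (k : ι → ℤ) :
    toTorus (x + fun i => (k i : ℝ)) = toTorus x := by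
  funext i
  have : ((k i : ℝ) : UnitAddCircle) = 0 := by
    rw [AddCircle.coe_eq_zero_iff]; exact ⟨k i, by simp⟩
  rw [toTorus, Pi.add_apply, AddCircle.coe_add, this, add_zero, toTorus]

variable [Fintype ι]

theorem measurableSet_unitBox (a : ι → ℝ) : MeasurableSet (unitBox a) := by
  rw [unitBox_eq_pi]
  exact MeasurableSet.univ_pi fun i => measurableSet_Ioc

theorem volume_unitBox (a : ι → ℝ) : volume (unitBox a) = 1 := by
  rw [unitBox_eq_pi, volume_pi_pi]; simp

/-- The sum of `F` over all integer translates. -/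
noncomputable def periodization (F : (ι → ℝ) → ℝ≥0∞) (y : ι → ℝ) : ℝ≥0∞ :=
  ∑' k : ι → ℤ, F (y + fun i => (k i : ℝ))

theorem measurable_periodization {F : (ι → ℝ) → ℝ≥0∞} (hF : Measurable F) :
    Measurable (periodization F) :=
  Measurable.tsum fun _ => hF.comp (measurable_add_const _)

/-- The integer translates of a half-open unit box tile the space. -/
theorem lintegral_eq_lintegral_unitBox_periodization {F : (ι → ℝ) → ℝ≥0∞} (hF : Measurable F)
    (a : ι → ℝ) : ∫⁻ y, F y = ∫⁻ y in unitBox a, periodization F y := by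
  have hm : ∀ k : ι → ℤ, Measurable fun y : ι → ℝ => y + fun i => (k i : ℝ) :=
    fun k => measurable_add_const _
  have hex : ∀ y : ι → ℝ, ∃ k : ι → ℤ, (y + fun i => (k i : ℝ)) ∈ unitBox a := fun y => by
    choose k hk _ using fun i => existsUnique_add_zsmul_mem_Ioc (one_pos (α := ℝ)) (y i) (a i)
    exact ⟨k, fun i => by simpa using hk i⟩
  have huniv : (⋃ k : ι → ℤ, (fun y : ι → ℝ => y + fun i => (k i : ℝ)) ⁻¹' unitBox a)
      = Set.univ := by
    ext y; simpa using hex y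
  have hdisj : Pairwise (Function.onFun Disjoint
      fun k : ι → ℤ => (fun y : ι → ℝ => y + fun i => (k i : ℝ)) ⁻¹' unitBox a) := by
    intro k l hkl
    refine Set.disjoint_left.2 fun y hk hl => hkl (funext fun i => ?_)
    refine (existsUnique_add_zsmul_mem_Ioc (one_pos (α := ℝ)) (y i) (a i)).unique ?_ ?_
    · simpa using hk i
    · simpa using hl i
  rw [← setLIntegral_univ, ← huniv,
    lintegral_iUnion (fun k => hm k (measurableSet_unitBox a)) hdisj]
  unfold periodization
  -- The preimage of the box under translation by `k` is the box moved by `-k`, hence the reindexing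
  -- by negation.
  rw [lintegral_tsum fun k => (show Measurable fun y : ι → ℝ => F (y + fun i => ((k i : ℤ) : ℝ))
    from hF.comp (hm k)).aemeasurable, ← (Equiv.neg (ι → ℤ)).tsum_eq]
  refine tsum_congr fun k => ?_
  have hp := measurePreserving_add_right (volume : Measure (ι → ℝ)) fun i => (k i : ℝ)
  rw [← hp.setLIntegral_comp_preimage_emb (measurableEmbedding_addRight _), Set.preimage_preimage]
  simp only [Equiv.neg_apply, Pi.neg_apply, Int.cast_neg]
  congr 2
  ext y
  simp [unitBox]

/-- The probability Haar measure on the torus. -/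
noncomputable abbrev torusHaar (ι : Type*) [Fintype ι] : Measure (UnitAddTorus ι) :=
  Measure.pi fun _ => AddCircle.haarAddCircle

theorem lintegral_torusHaar (ψ : UnitAddTorus ι → ℝ≥0∞) (a : ι → ℝ) :
    ∫⁻ x, ψ x ∂torusHaar ι = ∫⁻ y in unitBox a, ψ (toTorus y) :=
  UnitAddTorus.lintegral_preimage ψ a

/-- The push-forward to the torus of the measure with density `F`. -/
noncomputable def torusMeasure (F : (ι → ℝ) → ℝ≥0∞) : Measure (UnitAddTorus ι) :=
  (volume.withDensity F).map toTorus

theorem lintegral_torusMeasure {F : (ι → ℝ) → ℝ≥0∞} (hF : Measurable F)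
    {ψ : UnitAddTorus ι → ℝ≥0∞} (hψ : Measurable ψ) (a : ι → ℝ) :
    ∫⁻ x, ψ x ∂torusMeasure F = ∫⁻ y in unitBox a, ψ (toTorus y) * periodization F y := by
  have hq : Measurable fun y : ι → ℝ => ψ (toTorus y) := hψ.comp measurable_toTorus
  rw [torusMeasure, lintegral_map hψ measurable_toTorus,
    lintegral_withDensity_eq_lintegral_mul _ hF hq,
    lintegral_eq_lintegral_unitBox_periodization (hF.mul hq) a]
  refine lintegral_congr fun y => ?_
  simp only [periodization, Pi.mul_apply, toTorus_add_intCast]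
  rw [ENNReal.tsum_mul_right, mul_comm]

theorem torusMeasure_eq_of_periodization_eq {F : (ι → ℝ) → ℝ≥0∞} (hF : Measurable F) {c : ℝ≥0∞}
    (h : ∀ y, periodization F y = c) : torusMeasure F = c • torusHaar ι := by
  refine Measure.ext_of_lintegral _ fun ψ hψ => ?_
  rw [lintegral_torusMeasure hF hψ 0, lintegral_smul_measure,
    lintegral_torusHaar ψ 0, smul_eq_mul, mul_comm,
    ← lintegral_mul_const _ (f := fun y => ψ (toTorus y)) (hψ.comp measurable_toTorus)]
  simp only [h]

/-- The projection restricted to a unit box has a measurable inverse, so the indicator of any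
measurable subset of the box is a test function on the torus. -/
theorem ae_periodization_eq_of_torusMeasure_eq {F : (ι → ℝ) → ℝ≥0∞} (hF : Measurable F)
    {c : ℝ≥0∞} (h : torusMeasure F = c • torusHaar ι) (a : ι → ℝ) :
    ∀ᵐ y ∂volume.restrict (unitBox a), periodization F y = c := by
  let e : UnitAddTorus ι → ι → ℝ := fun x => (UnitAddTorus.measurableEquivPiIoc a x).1
  have he : Measurable e :=
    measurable_subtype_coe.comp (UnitAddTorus.measurableEquivPiIoc a).measurable
  have heq : ∀ y ∈ unitBox a, e (toTorus y) = y := fun y hy =>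
    congrArg Subtype.val ((UnitAddTorus.measurableEquivPiIoc a).apply_symm_apply ⟨y, hy⟩)
  refine ae_eq_of_forall_setLIntegral_eq_of_sigmaFinite (measurable_periodization hF)
    measurable_const fun s hs _ => ?_
  let ψ : UnitAddTorus ι → ℝ≥0∞ := fun x => s.indicator 1 (e x)
  have hψ : Measurable ψ := (measurable_one.indicator hs).comp he
  have h1 := lintegral_torusMeasure hF hψ a
  rw [h, lintegral_smul_measure, lintegral_torusHaar ψ a, smul_eq_mul,
    ← lintegral_const_mul _ (f := fun y => ψ (toTorus y)) (hψ.comp measurable_toTorus)] at h1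
  rw [← lintegral_indicator hs, ← lintegral_indicator hs]
  calc
    _ = ∫⁻ y in unitBox a, ψ (toTorus y) * periodization F y := ?_
    _ = _ := h1.symm
    _ = _ := ?_
  · refine setLIntegral_congr_fun (measurableSet_unitBox a) fun y hy => ?_
    by_cases hys : y ∈ s <;> simp [ψ, heq y hy, hys]
  · refine setLIntegral_congr_fun (measurableSet_unitBox a) fun y hy => ?_
    by_cases hys : y ∈ s <;> simp [ψ, heq y hy, hys]

theorem dense_periodization_eq_of_torusMeasure_eq {F : (ι → ℝ) → ℝ≥0∞} (hF : Measurable F)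
    {c : ℝ≥0∞} (h : torusMeasure F = c • torusHaar ι) : Dense {y | periodization F y = c} := by
  have hall : ∀ᵐ y, periodization F y = c := by
    have hcov : ∀ y : ι → ℝ, ∃ k : ι → ℤ, y ∈ unitBox fun i => (k i : ℝ) := fun y => by
      -- The boxes are open at the lower corner and closed at the upper one, so the corner is the
      -- ceiling minus one and not the floor.
      refine ⟨fun i => ⌈y i⌉ - 1, fun i => ⟨?_, ?_⟩⟩
      · have := Int.ceil_lt_add_one (y i); push_cast; linarith
      · have := Int.le_ceil (y i); push_cast; linarith
    have := ae_all_iff.2 fun k : ι → ℤ => (ae_restrict_iff' (measurableSet_unitBox _)).1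
      (ae_periodization_eq_of_torusMeasure_eq hF h fun i => (k i : ℝ))
    filter_upwards [this] with y hy
    obtain ⟨k, hk⟩ := hcov y
    exact hy k hk
  exact Measure.dense_of_ae hall

theorem mFourier_toTorus (k : ι → ℤ) (y : ι → ℝ) :
    UnitAddTorus.mFourier k (toTorus y)
      = Complex.exp (2 * Real.pi * Complex.I * ((∑ i, k i * y i : ℝ) : ℂ)) := by
  simp only [UnitAddTorus.mFourier, toTorus, ContinuousMap.coe_mk, fourier_coe_apply]
  rw [← Complex.exp_sum]
  congr 1
  push_cast
  rw [Finset.mul_sum]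
  refine Finset.sum_congr rfl fun i _ => ?_
  simp; ring

theorem integral_mFourier_eq_zero {k : ι → ℤ} (hk : k ≠ 0) :
    ∫ x, UnitAddTorus.mFourier k x ∂torusHaar ι = 0 := by
  classical
  obtain ⟨i, hi⟩ := Function.ne_iff.1 hk
  simp only [UnitAddTorus.mFourier, ContinuousMap.coe_mk]
  rw [integral_fintype_prod_eq_prod (f := fun i (x : UnitAddCircle) => fourier (k i) x)]
  refine Finset.prod_eq_zero (Finset.mem_univ i) ?_
  have := (orthonormal_iff_ite.mp <| orthonormal_fourier (T := 1)) 0 (k i)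
  rw [if_neg (fun h0 : (0 : ℤ) = k i => hi h0.symm)] at this
  simpa [ContinuousMap.inner_toLp] using! this

theorem integral_torusMeasure {F : (ι → ℝ) → ℝ} (hF : Measurable F) (h0 : ∀ y, 0 ≤ F y)
    (ψ : C(UnitAddTorus ι, ℂ)) :
    ∫ x, ψ x ∂torusMeasure (fun y => ENNReal.ofReal (F y)) = ∫ y, F y * ψ (toTorus y) := by
  rw [torusMeasure, integral_map measurable_toTorus.aemeasurable
    ψ.continuous.aestronglyMeasurable, 
    integral_withDensity_eq_integral_toReal_smul hF.ennreal_ofReal (by simp)]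
  simp [ENNReal.toReal_ofReal (h0 _)]

theorem isFiniteMeasure_torusMeasure {F : (ι → ℝ) → ℝ} (hF : Integrable F) :
    IsFiniteMeasure (torusMeasure fun y => ENNReal.ofReal (F y)) := by
  have := isFiniteMeasure_withDensity_ofReal hF.2
  exact Measure.isFiniteMeasure_map _ _

/-- A finite measure on the torus is determined by its Fourier coefficients. -/
theorem torus_measure_ext {P Q : Measure (UnitAddTorus ι)} [IsFiniteMeasure P] [IsFiniteMeasure Q]
    (h : ∀ k : ι → ℤ, ∫ x, UnitAddTorus.mFourier k x ∂P = ∫ x, UnitAddTorus.mFourier k x ∂Q) :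
    P = Q := by
  have hint : ∀ (R : Measure (UnitAddTorus ι)) [IsFiniteMeasure R] (ψ : C(UnitAddTorus ι, ℂ)),
      Integrable ψ R := fun R _ ψ => 
    Integrable.of_bound ψ.continuous.aestronglyMeasurable ‖ψ‖ (.of_forall ψ.norm_coe_le_norm)
  have hspan : ∀ ψ ∈ Submodule.span ℂ (Set.range (UnitAddTorus.mFourier (d := ι))),
      ∫ x, ψ x ∂P = ∫ x, ψ x ∂Q := by
    intro ψ hψ
    induction hψ using Submodule.span_induction with
    | mem x hx => obtain ⟨k, rfl⟩ := hx; exact h k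
    | zero => simp
    | add x y _ _ hx hy =>
      simp only [ContinuousMap.add_apply]
      rw [integral_add (hint P x) (hint P y), integral_add (hint Q x) (hint Q y), hx, hy]
    | smul c x _ hx =>
      simp only [ContinuousMap.smul_apply]
      rw [integral_smul, integral_smul, hx]
  rw [← UnitAddTorus.mFourierSubalgebra_coe] at hspan
  -- Trigonometric polynomials form a star subalgebra that separates points, which suffices to
  -- determine a finite measure.
  refine ext_of_forall_mem_subalgebra_integral_eq_of_polish (𝕜 := ℂ)
    (A := (UnitAddTorus.mFourierSubalgebra ι).comap
      (BoundedContinuousFunction.toContinuousMapStarₐ (α := UnitAddTorus ι) ℂ)) ?_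
    fun ψ hψ => hspan _ hψ
  intro x y hxy
  obtain ⟨_, ⟨ψ, hψ, rfl⟩, h⟩ := UnitAddTorus.mFourierSubalgebra_separatesPoints hxy
  exact ⟨_, ⟨ψ, ⟨BoundedContinuousFunction.mkOfCompact ψ, hψ, rfl⟩, rfl⟩, h⟩

theorem integral_mul_char_eq_zero_of_periodization_eq {F : (ι → ℝ) → ℝ} (hF : Measurable F)
    (h0 : ∀ y, 0 ≤ F y) {c : ℝ≥0∞} (h : ∀ y, periodization (fun y => ENNReal.ofReal (F y)) y = c)
    {k : ι → ℤ} (hk : k ≠ 0) :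
    ∫ y, F y * Complex.exp (2 * Real.pi * Complex.I * ((∑ i, k i * y i : ℝ) : ℂ)) = 0 := by
  have := integral_torusMeasure hF h0 (UnitAddTorus.mFourier k)
  simp only [mFourier_toTorus] at this
  rw [← this, torusMeasure_eq_of_periodization_eq hF.ennreal_ofReal h, integral_smul_measure,
    integral_mFourier_eq_zero hk, smul_zero]

theorem lintegral_eq_of_periodization_eq {F : (ι → ℝ) → ℝ≥0∞} (hF : Measurable F) {c : ℝ≥0∞}
    (h : ∀ y, periodization F y = c) : ∫⁻ y, F y = c := by
  rw [lintegral_eq_lintegral_unitBox_periodization hF 0]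
  simp [h, volume_unitBox]

/-- If all Fourier coefficients of `F ≥ 0` at nonzero integer frequencies vanish, then the
periodization of `F` is constant on a dense set. -/
theorem dense_periodization_eq {F : (ι → ℝ) → ℝ} (hm : Measurable F) (hF : Integrable F)
    (h0 : ∀ y, 0 ≤ F y) (h : ∀ k : ι → ℤ, k ≠ 0 →
      ∫ y, F y * Complex.exp (2 * Real.pi * Complex.I * ((∑ i, k i * y i : ℝ) : ℂ)) = 0) :
    Dense {y | periodization (fun y => ENNReal.ofReal (F y)) y = ENNReal.ofReal (∫ y, F y)} := by
  have := isFiniteMeasure_torusMeasure hF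
  have : IsFiniteMeasure (ENNReal.ofReal (∫ y, F y) • torusHaar ι) :=
    Measure.smul_finite _ ENNReal.ofReal_ne_top
  refine dense_periodization_eq_of_torusMeasure_eq hm.ennreal_ofReal (torus_measure_ext fun k => ?_)
  rw [integral_torusMeasure hm h0]
  simp only [mFourier_toTorus]
  rw [integral_smul_measure]
  rcases eq_or_ne k 0 with rfl | hk
  · have hi : 0 ≤ ∫ y, F y := integral_nonneg h0
    simp [UnitAddTorus.mFourier_zero, ENNReal.toReal_ofReal hi, integral_complex_ofReal]
  · rw [h k hk, integral_mFourier_eq_zero hk, smul_zero]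

end Periodization

/-- The unit complex number `e^{2πir}`. -/
noncomputable def phase (r : ℝ) : ℂ := Complex.exp (2 * Real.pi * Complex.I * (r : ℂ))

theorem phase_zero : phase 0 = 1 := by simp [phase]

theorem phase_add (r s : ℝ) : phase (r + s) = phase r * phase s := by
  rw [phase, phase, phase, ← Complex.exp_add]; push_cast; ring_nf

theorem conj_phase (r : ℝ) : conj (phase r) = phase (-r) := by
  rw [phase, phase, ← Complex.exp_conj]
  simp [Complex.conj_ofNat]

theorem norm_phase (r : ℝ) : ‖phase r‖ = 1 := by
  have he : 2 * (Real.pi : ℂ) * Complex.I * (r : ℂ)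
      = ((2 * Real.pi * r : ℝ) : ℂ) * Complex.I := by
    push_cast; ring
  rw [phase, he, Complex.norm_exp_ofReal_mul_I]

theorem phase_neg_mul_phase (r : ℝ) : phase (-r) * phase r = 1 := by
  rw [← phase_add, neg_add_cancel, phase_zero]

theorem continuous_phase : Continuous phase := by unfold phase; fun_prop

/-! ### Algebra and continuity of time-frequency shifts -/

section TimeFrequencyShift

variable {d : ℕ}

local notation "𝔼" => EuclideanSpace ℝ (Fin d)

theorem shiftFun_eq (z : PhaseSpace d) (f : 𝔼 → ℂ) (t : 𝔼) :
    shiftFun z f t = phase (inner ℝ (freq z) t) * f (t - pos z) := rfl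

theorem pos_add (z w : PhaseSpace d) : pos (z + w) = pos z + pos w := rfl

theorem freq_add (z w : PhaseSpace d) : freq (z + w) = freq z + freq w := rfl

theorem pos_zero : pos (0 : PhaseSpace d) = 0 := rfl

theorem freq_zero : freq (0 : PhaseSpace d) = 0 := rfl

theorem continuous_pos : Continuous (pos : PhaseSpace d → 𝔼) :=
  (PiLp.continuous_toLp 2 _).comp (by fun_prop)

theorem continuous_freq : Continuous (freq : PhaseSpace d → 𝔼) :=
  (PiLp.continuous_toLp 2 _).comp (by fun_prop)

theorem coeFn_tfShift (z : PhaseSpace d) (f : L2 d) : tfShift z f =ᵐ[volume] shiftFun z f :=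
  MemLp.coeFn_toLp _

theorem ae_comp_sub {p : 𝔼 → Prop} (h : ∀ᵐ t, p t) (x : 𝔼) : ∀ᵐ t, p (t - x) :=
  (measurePreserving_sub_right volume x).quasiMeasurePreserving.ae h

theorem tfShift_zero (f : L2 d) : tfShift 0 f = f := by
  refine Lp.ext ?_
  filter_upwards [coeFn_tfShift 0 f] with t ht
  rw [ht, shiftFun_eq, freq_zero, pos_zero, inner_zero_left, phase_zero, one_mul, sub_zero]

theorem tfShift_tfShift (z w : PhaseSpace d) (f : L2 d) :
    tfShift z (tfShift w f) = phase (-inner ℝ (freq w) (pos z)) • tfShift (z + w) f := by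
  refine Lp.ext ?_
  filter_upwards [coeFn_tfShift z (tfShift w f), ae_comp_sub (coeFn_tfShift w f) (pos z),
    Lp.coeFn_smul (phase (-inner ℝ (freq w) (pos z))) (tfShift (z + w) f),
    coeFn_tfShift (z + w) f] with t h1 h2 h3 h4
  rw [h1, h3, Pi.smul_apply, h4, shiftFun_eq, h2, shiftFun_eq, shiftFun_eq, smul_eq_mul,
    ← mul_assoc, ← mul_assoc, ← phase_add, ← phase_add, pos_add, freq_add, inner_sub_right,
    inner_add_left, sub_sub]
  ring_nf

theorem tfShift_add (z : PhaseSpace d) (f g : L2 d) :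
    tfShift z (f + g) = tfShift z f + tfShift z g := by
  refine Lp.ext ?_
  filter_upwards [coeFn_tfShift z (f + g), ae_comp_sub (Lp.coeFn_add f g) (pos z),
    Lp.coeFn_add (tfShift z f) (tfShift z g), coeFn_tfShift z f, coeFn_tfShift z g]
    with t h1 h2 h3 h4 h5
  rw [h1, h3, Pi.add_apply, h4, h5, shiftFun_eq, h2, shiftFun_eq, shiftFun_eq, Pi.add_apply,
    mul_add]

theorem tfShift_smul (z : PhaseSpace d) (c : ℂ) (f : L2 d) :
    tfShift z (c • f) = c • tfShift z f := by
  refine Lp.ext ?_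
  filter_upwards [coeFn_tfShift z (c • f), ae_comp_sub (Lp.coeFn_smul c f) (pos z),
    Lp.coeFn_smul c (tfShift z f), coeFn_tfShift z f] with t h1 h2 h3 h4
  rw [h1, h3, Pi.smul_apply, h4, shiftFun_eq, h2, shiftFun_eq, Pi.smul_apply, smul_eq_mul,
    smul_eq_mul, mul_left_comm]

/-- The time-frequency shift as a linear map. -/
noncomputable def tfShiftLinearMap (z : PhaseSpace d) : L2 d →ₗ[ℂ] L2 d where
  toFun := tfShift z
  map_add' := tfShift_add z
  map_smul' := tfShift_smul z

theorem tfShift_sub (z : PhaseSpace d) (f g : L2 d) :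
    tfShift z (f - g) = tfShift z f - tfShift z g :=
  map_sub (tfShiftLinearMap z) f g

theorem inner_tfShift_tfShift (z : PhaseSpace d) (f g : L2 d) :
    inner ℂ (tfShift z f) (tfShift z g) = inner ℂ f g := by
  rw [L2.inner_def, L2.inner_def,
    ← integral_sub_right_eq_self (fun t => inner ℂ (f t) (g t)) (pos z)]
  refine integral_congr_ae ?_
  filter_upwards [coeFn_tfShift z f, coeFn_tfShift z g] with t h1 h2
  rw [h1, h2, shiftFun_eq, shiftFun_eq, RCLike.inner_apply, RCLike.inner_apply, map_mul,
    conj_phase]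
  linear_combination (g (t - pos z) * conj (f (t - pos z))) *
    phase_neg_mul_phase (inner ℝ (freq z) t)

theorem norm_tfShift (z : PhaseSpace d) (f : L2 d) : ‖tfShift z f‖ = ‖f‖ := by
  have h := inner_tfShift_tfShift z f f
  rw [inner_self_eq_norm_sq_to_K, inner_self_eq_norm_sq_to_K] at h
  have h' : ‖tfShift z f‖ ^ 2 = ‖f‖ ^ 2 := by exact_mod_cast h
  exact (pow_left_inj₀ (norm_nonneg _) (norm_nonneg _) two_ne_zero).1 h'

/-- On a complex Hilbert space an operator with vanishing quadratic form is zero, by polarization;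
an isometry of a nontrivial space is not. -/
theorem exists_inner_tfShift_ne_zero [Nontrivial (L2 d)] (z : PhaseSpace d) :
    ∃ f : L2 d, inner ℂ f (tfShift z f) ≠ 0 := by
  by_contra! h
  have h0 : tfShiftLinearMap z = 0 :=
    inner_map_self_eq_zero _ |>.1 fun f => by
      rw [← inner_conj_symm]
      exact (congrArg _ (h f)).trans (map_zero _)
  obtain ⟨f, hf⟩ := exists_ne (0 : L2 d)
  have h1 : tfShift z f = 0 := LinearMap.congr_fun h0 f
  exact hf (norm_eq_zero.1 (by rw [← norm_tfShift z, h1, norm_zero]))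

/-- Covariance: the commutation phase disappears in absolute value, so a shift of the spectrogram's
argument can be moved onto `f`. -/
theorem norm_inner_tfShift_add (z w : PhaseSpace d) (f g : L2 d) :
    ‖inner ℂ (tfShift (z + w) g) f‖ = ‖inner ℂ (tfShift w g) (tfShift (-z) f)‖ := by
  rw [← inner_tfShift_tfShift (-z) (tfShift (z + w) g) f, tfShift_tfShift, inner_smul_left,
    norm_mul, RCLike.norm_conj, norm_phase, one_mul, neg_add_cancel_left]

theorem norm_inner_tfShift_tfShift (z w : PhaseSpace d) (g : L2 d) :
    ‖inner ℂ (tfShift z g) (tfShift w g)‖ = ‖inner ℂ g (tfShift (w - z) g)‖ := by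
  rw [← inner_tfShift_tfShift z g, tfShift_tfShift, inner_smul_right, norm_mul, norm_phase,
    one_mul, add_sub_cancel]

/-- The integrand of the short-time Fourier transform. -/
noncomputable def stftIntegrand (g f : 𝔼 → ℂ) (x t : 𝔼) : ℂ := conj (g (t - x)) * f t

theorem integrable_stftIntegrand {f g : 𝔼 → ℂ} (hf : MemLp f 2) (hg : MemLp g 2) (x : 𝔼) :
    Integrable (stftIntegrand g f x) := by
  have h1 : MemLp (fun t => g (t - x)) 2 volume :=
    hg.comp_measurePreserving (measurePreserving_sub_right volume x)
  exact h1.star.integrable_mul hf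

theorem inner_tfShift_eq_fourier (z : PhaseSpace d) (f g : L2 d) :
    inner ℂ (tfShift z g) f = 𝓕 (stftIntegrand g f (pos z)) (freq z) := by
  rw [L2.inner_def, Real.fourier_eq']
  refine integral_congr_ae ?_
  filter_upwards [coeFn_tfShift z g] with t ht
  rw [ht, shiftFun_eq, RCLike.inner_apply, map_mul, conj_phase, stftIntegrand, phase, smul_eq_mul,
    real_inner_comm]
  push_cast
  ring_nf

theorem continuous_inner_tfShift_of_fixed_pos (x : 𝔼) (f g : L2 d) :
    Continuous fun ξ : 𝔼 => 𝓕 (stftIntegrand g f x) ξ :=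
  continuous_fourier_of_integrable (integrable_stftIntegrand (Lp.memLp f) (Lp.memLp g) x)

/-- Translation `f ↦ f(· - x)` on `L²`. -/
noncomputable def translate (x : 𝔼) (f : L2 d) : L2 d :=
  Lp.compMeasurePreserving (fun t => t - x) (measurePreserving_sub_right volume x) f

theorem continuous_translate (f : L2 d) : Continuous fun x : 𝔼 => translate x f := by
  have hc : Continuous fun x : 𝔼 => (⟨fun t => t - x, by fun_prop⟩ : C(𝔼, 𝔼)) :=
    ContinuousMap.continuous_of_continuous_uncurry _ (by
      change Continuous fun p : 𝔼 × 𝔼 => p.2 - p.1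
      fun_prop)
  exact continuous_const.compMeasurePreservingLp hc
    (fun x => measurePreserving_sub_right volume x) (by norm_num)

/-- The phase space point `(x, ξ)`. -/
def phasePoint (x ξ : 𝔼) : PhaseSpace d := Sum.elim x ξ

theorem pos_phasePoint (x ξ : 𝔼) : pos (phasePoint x ξ) = x := rfl

theorem freq_phasePoint (x ξ : 𝔼) : freq (phasePoint x ξ) = ξ := rfl

theorem phasePoint_pos_freq (z : PhaseSpace d) : phasePoint (pos z) (freq z) = z := by
  funext i; cases i <;> rfl

theorem tfShift_eq_modulate_translate (z : PhaseSpace d) (f : L2 d) :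
    tfShift z f = tfShift (phasePoint 0 (freq z)) (translate (pos z) f) := by
  refine Lp.ext ?_
  filter_upwards [coeFn_tfShift z f,
    coeFn_tfShift (phasePoint 0 (freq z)) (translate (pos z) f),
    Lp.coeFn_compMeasurePreserving f (measurePreserving_sub_right volume (pos z))]
    with t h1 h2 h3
  rw [h1, h2, shiftFun_eq, shiftFun_eq, freq_phasePoint, pos_phasePoint, sub_zero]
  exact congrArg _ h3.symm

/-- With the translation frozen at `pos z₀`, the map is a Fourier transform of an `L¹` function and
so continuous. The error of freezing is controlled uniformly in the frequency, since modulations are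
isometric and translation is strongly continuous. -/
theorem continuous_inner_tfShift (f g : L2 d) :
    Continuous fun z : PhaseSpace d => inner ℂ (tfShift z g) f := by
  rw [continuous_iff_continuousAt]
  intro z₀
  have h1 : Continuous fun z : PhaseSpace d =>
      inner ℂ (tfShift (phasePoint 0 (freq z)) (translate (pos z₀) g)) f := by
    simp only [inner_tfShift_eq_fourier, pos_phasePoint, freq_phasePoint]
    exact (continuous_inner_tfShift_of_fixed_pos 0 f _).comp continuous_freq
  have h2 : Filter.Tendsto (fun z : PhaseSpace d => inner ℂ (tfShift (phasePoint 0 (freq z))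
      (translate (pos z) g - translate (pos z₀) g)) f) (𝓝 z₀) (𝓝 0) := by
    have h3 : Filter.Tendsto (fun z : PhaseSpace d =>
        ‖translate (pos z) g - translate (pos z₀) g‖ * ‖f‖) (𝓝 z₀) (𝓝 0) := by
      have : Continuous fun z : PhaseSpace d =>
          ‖translate (pos z) g - translate (pos z₀) g‖ * ‖f‖ :=
        (((continuous_translate g).comp continuous_pos).sub continuous_const).norm.mul
          continuous_const
      simpa using this.tendsto z₀
    refine squeeze_zero_norm (fun z => (norm_inner_le_norm _ _).trans_eq ?_) h3
    rw [norm_tfShift]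
  have h4 := h2.add (h1.tendsto z₀)
  rw [zero_add, ← tfShift_eq_modulate_translate] at h4
  refine h4.congr fun z => ?_
  rw [tfShift_sub, inner_sub_left, ← tfShift_eq_modulate_translate, sub_add_cancel]

/-- By isometry, `‖π(z)f - f‖² = 2‖f‖² - 2 Re⟨π(z)f, f⟩`, so weak continuity gives strong
continuity. -/
theorem continuous_tfShift_at_zero (f : L2 d) :
    Filter.Tendsto (fun z : PhaseSpace d => tfShift z f) (𝓝 0) (𝓝 f) := by
  rw [tendsto_iff_norm_sub_tendsto_zero]
  have h : Continuous fun z : PhaseSpace d =>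
      √(2 * ‖f‖ ^ 2 - 2 * RCLike.re (inner ℂ (tfShift z f) f)) := by
    have := continuous_inner_tfShift f f
    fun_prop
  have h0 := h.tendsto 0
  simp only [tfShift_zero] at h0
  rw [show 2 * ‖f‖ ^ 2 - 2 * RCLike.re (inner ℂ f f) = 0 by
    rw [inner_self_eq_norm_sq]; ring, Real.sqrt_zero] at h0
  refine h0.congr fun z => ?_
  rw [← Real.sqrt_sq (norm_nonneg (tfShift z f - f)), norm_sub_sq (𝕜 := ℂ), norm_tfShift]
  ring_nf

end TimeFrequencyShift

/-! ### The Fourier transform of the spectrogram -/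

section Moyal

variable {d : ℕ}

local notation "𝔼" => EuclideanSpace ℝ (Fin d)

theorem integrable_mul_comp_sub {F G : 𝔼 → ℂ} (hF : Integrable F) (hG : Integrable G) :
    Integrable (fun p : 𝔼 × 𝔼 => F p.2 * G (p.2 - p.1)) (volume.prod volume) := by
  have := hF.convolution_integrand (ContinuousLinearMap.mul ℂ ℂ) hG.comp_neg
    (μ := (volume : Measure 𝔼)) (ν := (volume : Measure 𝔼))
  simpa using this

theorem integral_phase_mul_integral_mul_comp_sub {F G : 𝔼 → ℂ} (hF : Integrable F)
    (hG : Integrable G) (η : 𝔼) :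
    ∫ x, phase (inner ℝ x η) * ∫ t, F t * G (t - x)
      = (∫ t, F t * phase (inner ℝ t η)) * ∫ s, G s * phase (-inner ℝ s η) := by
  have hint : Integrable (fun p : 𝔼 × 𝔼 => phase (inner ℝ p.1 η) * (F p.2 * G (p.2 - p.1)))
      (volume.prod volume) := by
    refine (integrable_mul_comp_sub hF hG).bdd_mul (c := 1) ?_ (.of_forall fun p => ?_)
    · exact (continuous_phase.comp (by fun_prop)).aestronglyMeasurable
    · rw [norm_phase]
  have e : ∀ x : 𝔼, phase (inner ℝ x η) * ∫ t, F t * G (t - x)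
      = ∫ t, phase (inner ℝ x η) * (F t * G (t - x)) := fun x => (integral_const_mul _ _).symm
  simp_rw [e]
  rw [integral_integral_swap hint, ← integral_mul_const]
  refine integral_congr_ae (.of_forall fun t => ?_)
  dsimp only
  -- After Fubini, the substitution `x = t - s` splits the phase into a factor in `t` and a factor
  -- in `s`.
  rw [← integral_sub_left_eq_self _ _ t, ← integral_const_mul]
  refine integral_congr_ae (.of_forall fun s => ?_)
  dsimp only
  rw [sub_sub_cancel, inner_sub_left, sub_eq_add_neg, phase_add]
  ring

theorem integrable_norm_sq {f : 𝔼 → ℂ} (hf : MemLp f 2) :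
    Integrable fun t => ((‖f t‖ ^ 2 : ℝ) : ℂ) :=
  (hf.integrable_norm_pow two_ne_zero).ofReal

theorem fourier_comp_add_right (h : 𝔼 → ℂ) (u ξ : 𝔼) :
    𝓕 (fun t => h (t + u)) ξ = phase (inner ℝ u ξ) * 𝓕 h ξ := by
  have := congrFun (VectorFourier.fourierIntegral_comp_add_right Real.fourierChar
    (volume : Measure 𝔼) (innerₗ 𝔼) h u) ξ
  refine Eq.trans this ?_
  rw [Circle.smul_def, Real.fourierChar_apply, smul_eq_mul, phase]
  congr 2
  simp only [innerₗ_apply_apply]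
  push_cast
  ring

variable (f g : L2 d)

/-- For fixed `x` the product of two `L²` functions is only `L¹`; since `|f(t)|²|g(t - x)|²` is
integrable in `(x, t)`, it is in `L²` for almost every `x`, as Plancherel requires. -/
theorem ae_memLp_stftIntegrand : ∀ᵐ x : 𝔼, MemLp (stftIntegrand g f x) 2 := by
  have h := integrable_mul_comp_sub (integrable_norm_sq (Lp.memLp f))
    (integrable_norm_sq (Lp.memLp g))
  filter_upwards [h.prod_right_ae] with x hx
  refine (memLp_two_iff_integrable_sq_norm
    (integrable_stftIntegrand (Lp.memLp f) (Lp.memLp g) x).1).2 ?_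
  refine hx.re.congr (.of_forall fun t => ?_)
  dsimp only
  rw [← Complex.ofReal_mul, stftIntegrand, norm_mul, RCLike.norm_conj, mul_pow, mul_comm]
  exact Complex.ofReal_re _

/-- Plancherel for the integrand and its translate by `u`: translation becomes multiplication by the
phase on the Fourier side. -/
theorem integral_norm_sq_fourier_stftIntegrand_mul_phase (u : 𝔼) :
    ∀ᵐ x : 𝔼, ∫ ξ, ((‖𝓕 (stftIntegrand g f x) ξ‖ ^ 2 : ℝ) : ℂ) * phase (inner ℝ u ξ)
      = ∫ t, (conj (f t) * f (t + u)) * (g (t - x) * conj (g (t - x + u))) := by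
  filter_upwards [ae_memLp_stftIntegrand f g] with x hx
  have h1 := integrable_stftIntegrand (Lp.memLp f) (Lp.memLp g) x
  have hp := measurePreserving_add_right (volume : Measure 𝔼) u
  have key := integral_conj_fourier_mul_fourier h1 hx (h1.comp_add_right u)
    (hx.comp_measurePreserving hp)
  simp only [fourier_comp_add_right] at key
  refine Eq.trans (integral_congr_ae (.of_forall fun ξ => ?_)) (key.trans
    (integral_congr_ae (.of_forall fun t => ?_)))
  · dsimp only
    rw [mul_left_comm, ← Complex.normSq_eq_conj_mul_self, Complex.normSq_eq_norm_sq, mul_comm]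
  · simp only [stftIntegrand, map_mul, Complex.conj_conj]
    rw [show t + u - x = t - x + u by abel]
    ring

theorem integrable_conj_mul_comp_add (u : 𝔼) : Integrable fun t => conj (f t) * f (t + u) := by
  have h1 : MemLp (fun t => f (t + u)) 2 volume :=
    (Lp.memLp f).comp_measurePreserving (measurePreserving_add_right volume u)
  exact (Lp.memLp f).star.integrable_mul h1

theorem integrable_mul_conj_comp_add (u : 𝔼) : Integrable fun t => f t * conj (f (t + u)) := by
  have h1 : MemLp (fun t => f (t + u)) 2 volume :=
    (Lp.memLp f).comp_measurePreserving (measurePreserving_add_right volume u)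
  exact (Lp.memLp f).integrable_mul h1.star

theorem continuous_stft :
    Continuous fun p : 𝔼 × 𝔼 => 𝓕 (stftIntegrand g f p.1) p.2 := by
  have hc : Continuous fun p : 𝔼 × 𝔼 => phasePoint p.1 p.2 := by
    refine continuous_pi fun i => ?_
    cases i <;> simp only [phasePoint, Sum.elim_inl, Sum.elim_inr] <;> fun_prop
  have := (continuous_inner_tfShift f g).comp hc
  simpa only [Function.comp_def, inner_tfShift_eq_fourier, pos_phasePoint, freq_phasePoint]
    using this

theorem integrable_norm_sq_stft :
    Integrable (fun p : 𝔼 × 𝔼 => ‖𝓕 (stftIntegrand g f p.1) p.2‖ ^ 2) (volume.prod volume) := by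
  rw [integrable_prod_iff (f := fun p : 𝔼 × 𝔼 => ‖𝓕 (stftIntegrand g f p.1) p.2‖ ^ 2)
    ((continuous_stft f g).norm.pow 2).aestronglyMeasurable]
  constructor
  · filter_upwards [ae_memLp_stftIntegrand f g] with x hx
    exact (memLp_fourier (integrable_stftIntegrand (Lp.memLp f) (Lp.memLp g) x) hx
      ).integrable_norm_pow two_ne_zero
  -- The case `u = 0` identifies the inner integral over frequency with a function of `x` that
  -- Fubini makes integrable.
  · have h := (integrable_mul_comp_sub (integrable_conj_mul_comp_add f 0)
      (integrable_mul_conj_comp_add g 0)).integral_prod_left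
    refine h.re.congr ?_
    filter_upwards [integral_norm_sq_fourier_stftIntegrand_mul_phase f g 0] with x hx
    simp only [inner_zero_left, phase_zero, mul_one] at hx
    rw [← hx, integral_complex_ofReal]
    simp

theorem inner_tfShift_right_eq (u η : 𝔼) :
    inner ℂ f (tfShift (phasePoint (-u) η) f)
      = ∫ t, (conj (f t) * f (t + u)) * phase (inner ℝ t η) := by
  rw [L2.inner_def]
  refine integral_congr_ae ?_
  filter_upwards [coeFn_tfShift (phasePoint (-u) η) f] with t ht
  rw [ht, shiftFun_eq, RCLike.inner_apply, pos_phasePoint, freq_phasePoint, sub_neg_eq_add,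
    real_inner_comm]
  ring

theorem inner_tfShift_left_eq (u η : 𝔼) :
    inner ℂ (tfShift (phasePoint (-u) η) g) g
      = ∫ t, (g t * conj (g (t + u))) * phase (-inner ℝ t η) := by
  rw [L2.inner_def]
  refine integral_congr_ae ?_
  filter_upwards [coeFn_tfShift (phasePoint (-u) η) g] with t ht
  rw [ht, shiftFun_eq, RCLike.inner_apply, pos_phasePoint, freq_phasePoint, sub_neg_eq_add,
    real_inner_comm, map_mul, conj_phase]
  ring

theorem integral_prod_norm_sq_stft_mul_phase (u η : 𝔼) :
    ∫ p : 𝔼 × 𝔼, ((‖𝓕 (stftIntegrand g f p.1) p.2‖ ^ 2 : ℝ) : ℂ)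
        * phase (inner ℝ p.1 η + inner ℝ u p.2) ∂(volume.prod volume)
      = inner ℂ f (tfShift (phasePoint (-u) η) f) *
        inner ℂ (tfShift (phasePoint (-u) η) g) g := by
  rw [integral_prod, inner_tfShift_right_eq, inner_tfShift_left_eq,
    ← integral_phase_mul_integral_mul_comp_sub (integrable_conj_mul_comp_add f u)
      (integrable_mul_conj_comp_add g u)]
  · refine integral_congr_ae ?_
    filter_upwards [integral_norm_sq_fourier_stftIntegrand_mul_phase f g u] with x hx
    rw [← hx, ← integral_const_mul]
    refine integral_congr_ae (.of_forall fun ξ => ?_)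
    dsimp only
    rw [phase_add]
    ring
  · refine (integrable_norm_sq_stft f g).ofReal.mul_bdd (c := 1) ?_ (.of_forall fun p => ?_)
    · exact (continuous_phase.comp (by fun_prop)).aestronglyMeasurable
    · rw [norm_phase]

/-- Phase space as the product of position space and frequency space. -/
noncomputable def phaseSpaceEquiv (d : ℕ) :
    PhaseSpace d ≃ᵐ EuclideanSpace ℝ (Fin d) × EuclideanSpace ℝ (Fin d) :=
  (MeasurableEquiv.sumPiEquivProdPi fun _ => ℝ).trans
    ((MeasurableEquiv.toLp 2 (Fin d → ℝ)).prodCongr (MeasurableEquiv.toLp 2 (Fin d → ℝ)))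

theorem measurePreserving_phaseSpaceEquiv :
    MeasurePreserving (phaseSpaceEquiv d) volume (volume.prod volume) :=
  ((PiLp.volume_preserving_toLp (Fin d)).prod (PiLp.volume_preserving_toLp (Fin d))).comp
    (volume_measurePreserving_sumPiEquivProdPi fun _ => ℝ)

theorem integrable_norm_sq_inner_tfShift :
    Integrable fun z : PhaseSpace d => ‖inner ℂ (tfShift z g) f‖ ^ 2 := by
  simp only [inner_tfShift_eq_fourier]
  exact (measurePreserving_phaseSpaceEquiv.integrable_comp_emb
    (phaseSpaceEquiv d).measurableEmbedding).2 (integrable_norm_sq_stft f g)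

/-- The Fourier transform of the spectrogram. -/
theorem integral_norm_sq_inner_tfShift_mul_phase (u η : 𝔼) :
    ∫ z : PhaseSpace d, ((‖inner ℂ (tfShift z g) f‖ ^ 2 : ℝ) : ℂ)
        * phase (inner ℝ (pos z) η + inner ℝ u (freq z))
      = inner ℂ f (tfShift (phasePoint (-u) η) f) *
        inner ℂ (tfShift (phasePoint (-u) η) g) g := by
  rw [← integral_prod_norm_sq_stft_mul_phase,
    ← measurePreserving_phaseSpaceEquiv.integral_comp (phaseSpaceEquiv d).measurableEmbedding]
  simp only [inner_tfShift_eq_fourier]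
  rfl

/-! ### Linear change of variables -/

section ChangeOfVariables

variable {ι : Type*} [Fintype ι] {A : Matrix ι ι ℝ}

theorem continuous_mulVec : Continuous fun y : ι → ℝ => A *ᵥ y :=
  continuous_const.matrix_mulVec continuous_id

variable [DecidableEq ι]

theorem map_mulVec_volume (hA : A.det ≠ 0) :
    (volume : Measure (ι → ℝ)).map (fun y => A *ᵥ y) = ENNReal.ofReal |A.det|⁻¹ • volume := by
  rw [← abs_inv]
  exact Real.map_matrix_volume_pi_eq_smul_volume_pi hA

theorem integral_comp_mulVec {G : (ι → ℝ) → ℂ} (hA : A.det ≠ 0) (hG : Continuous G) :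
    ∫ y, G (A *ᵥ y) = (|A.det|⁻¹ : ℝ) * ∫ z, G z := by
  rw [← integral_map continuous_mulVec.measurable.aemeasurable hG.aestronglyMeasurable,
    map_mulVec_volume hA, integral_smul_measure,
    ENNReal.toReal_ofReal (inv_nonneg.2 (abs_nonneg _)), Complex.real_smul]

theorem integrable_comp_mulVec {G : (ι → ℝ) → ℝ} (hA : A.det ≠ 0) (hG : Integrable G) :
    Integrable fun y => G (A *ᵥ y) := by
  have h : Integrable G ((volume : Measure (ι → ℝ)).map fun y => A *ᵥ y) := by
    rw [map_mulVec_volume hA]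
    exact hG.smul_measure ENNReal.ofReal_ne_top
  exact h.comp_measurable continuous_mulVec.measurable

end ChangeOfVariables

end Moyal

/-! ### Duality between the lattice and its adjoint -/

section Duality

variable {d : ℕ} {A : Matrix (Idx d) (Idx d) ℝ}

/-- An integer vector, regarded as a real vector. -/
def intVec (k : Idx d → ℤ) : PhaseSpace d := fun i => (k i : ℝ)

theorem intVec_sub (k l : Idx d → ℤ) : intVec (k - l) = intVec k - intVec l := by
  funext i; simp [intVec]

theorem intVec_injective : Function.Injective (intVec (d := d)) := fun _ _ h =>
  funext fun i => Int.cast_injective (congrFun h i)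

/-- The lattice sum `∑ |⟨f, π(λ) g⟩|²` over `λ ∈ A ℤ^{2d}`. -/
noncomputable def frameSum (A : Matrix (Idx d) (Idx d) ℝ) (g f : L2 d) : ℝ≥0∞ :=
  ∑' k : Idx d → ℤ, ENNReal.ofReal (‖inner ℂ (tfShift (A *ᵥ intVec k) g) f‖ ^ 2)

/-- The spectrogram of `f` with window `g` in lattice coordinates. -/
noncomputable def latticeSpectrogram (A : Matrix (Idx d) (Idx d) ℝ) (g f : L2 d)
    (y : PhaseSpace d) : ℝ :=
  ‖inner ℂ (tfShift (A *ᵥ y) g) f‖ ^ 2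

theorem latticeSpectrogram_nonneg (g f : L2 d) (y : PhaseSpace d) :
    0 ≤ latticeSpectrogram A g f y := sq_nonneg _

theorem continuous_latticeSpectrogram (g f : L2 d) : Continuous (latticeSpectrogram A g f) :=
  ((continuous_inner_tfShift f g).comp continuous_mulVec).norm.pow 2

theorem integrable_latticeSpectrogram (hA : A.det ≠ 0) (g f : L2 d) :
    Integrable (latticeSpectrogram A g f) :=
  integrable_comp_mulVec hA (integrable_norm_sq_inner_tfShift f g)

theorem periodization_latticeSpectrogram (g f : L2 d) (y : PhaseSpace d) :
    periodization (fun y => ENNReal.ofReal (latticeSpectrogram A g f y)) y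
      = frameSum A g (tfShift (-(A *ᵥ y)) f) := by
  refine tsum_congr fun k => ?_
  rw [← norm_inner_tfShift_add, ← Matrix.mulVec_add]
  rfl

/-- The point of the adjoint lattice with coordinates `-k`. -/
noncomputable def adjointPoint (A : Matrix (Idx d) (Idx d) ℝ) (k : Idx d → ℤ) : PhaseSpace d :=
  -(sympl d *ᵥ ((Aᵀ)⁻¹ *ᵥ intVec k))

theorem sympl_mulVec (z : PhaseSpace d) : sympl d *ᵥ z = phasePoint (freq z) (-pos z) := by
  rw [sympl, Matrix.fromBlocks_mulVec]
  funext i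
  cases i <;> simp [phasePoint, freq, pos, Matrix.neg_mulVec]

theorem adjointPoint_eq (k : Idx d → ℤ) : adjointPoint A k
    = phasePoint (-freq ((Aᵀ)⁻¹ *ᵥ intVec k)) (pos ((Aᵀ)⁻¹ *ᵥ intVec k)) := by
  rw [adjointPoint, sympl_mulVec]
  funext i
  cases i <;> simp [phasePoint]

theorem adjointPoint_mem (k : Idx d → ℤ) : adjointPoint A k ∈ adjointLattice A := by
  refine ⟨(Aᵀ)⁻¹ *ᵥ intVec (-k), ⟨-k, rfl⟩, ?_⟩
  have : intVec (-k) = -intVec k := by funext i; simp [intVec]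
  dsimp only
  rw [adjointPoint, this, Matrix.mulVec_neg, Matrix.mulVec_neg]

theorem adjointPoint_ne_zero (hA : A.det ≠ 0) {k : Idx d → ℤ} (hk : k ≠ 0) :
    adjointPoint A k ≠ 0 := by
  intro h
  rw [adjointPoint_eq] at h
  set m := (Aᵀ)⁻¹ *ᵥ intVec k with hm
  have h1 : freq m = 0 := neg_eq_zero.1 (congrArg pos h)
  have h2 : pos m = 0 := congrArg freq h
  have h0 : m = 0 := by
    rw [← phasePoint_pos_freq m, h1, h2]
    exact phasePoint_pos_freq 0
  have hk' : intVec k = Aᵀ *ᵥ m := by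
    rw [hm, Matrix.mulVec_mulVec, Matrix.mul_nonsing_inv _ (by simpa using hA), Matrix.one_mulVec]
  rw [h0, Matrix.mulVec_zero] at hk'
  exact hk (intVec_injective (hk'.trans (by funext i; simp [intVec])))

theorem inner_pos_add_inner_freq (z w : PhaseSpace d) :
    inner ℝ (pos z) (pos w) + inner ℝ (freq w) (freq z) = w ⬝ᵥ z := by
  simp only [dotProduct, Fintype.sum_sum_type, PiLp.inner_apply, pos, freq]
  simp [mul_comm]

/-- This is where the adjoint lattice enters: `k · y = (Aᵀ)⁻¹k · Ay`, so the integer character at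
`k` is the phase space character at `(Aᵀ)⁻¹k`. -/
theorem sum_intVec_mul (hA : A.det ≠ 0) (k : Idx d → ℤ) (y : PhaseSpace d) :
    ∑ i, (k i : ℝ) * y i = inner ℝ (pos (A *ᵥ y)) (pos ((Aᵀ)⁻¹ *ᵥ intVec k))
      + inner ℝ (freq ((Aᵀ)⁻¹ *ᵥ intVec k)) (freq (A *ᵥ y)) := by
  rw [inner_pos_add_inner_freq, ← Matrix.transpose_nonsing_inv, Matrix.mulVec_transpose,
    Matrix.dotProduct_mulVec, Matrix.vecMul_vecMul, Matrix.nonsing_inv_mul _ hA.isUnit,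
    Matrix.vecMul_one]
  rfl

theorem integral_latticeSpectrogram_mul_char (hA : A.det ≠ 0) (g f : L2 d) (k : Idx d → ℤ) :
    ∫ y, latticeSpectrogram A g f y
        * Complex.exp (2 * Real.pi * Complex.I * ((∑ i, k i * y i : ℝ) : ℂ))
      = ((vol A)⁻¹ : ℝ) * (inner ℂ f (tfShift (adjointPoint A k) f) *
        inner ℂ (tfShift (adjointPoint A k) g) g) := by
  have hc : Continuous fun z : PhaseSpace d => ((‖inner ℂ (tfShift z g) f‖ ^ 2 : ℝ) : ℂ)
      * phase (inner ℝ (pos z) (pos ((Aᵀ)⁻¹ *ᵥ intVec k))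
        + inner ℝ (freq ((Aᵀ)⁻¹ *ᵥ intVec k)) (freq z)) := by
    have h1 := continuous_inner_tfShift f g
    have h2 := continuous_pos (d := d)
    have h3 := continuous_freq (d := d)
    have h4 := continuous_phase
    fun_prop
  rw [adjointPoint_eq, ← integral_norm_sq_inner_tfShift_mul_phase, vol,
    ← integral_comp_mulVec hA hc]
  refine integral_congr_ae (.of_forall fun y => ?_)
  dsimp only
  rw [sum_intVec_mul hA]
  rfl

theorem integral_latticeSpectrogram (hA : A.det ≠ 0) (g f : L2 d) :
    ∫ y, latticeSpectrogram A g f y = (vol A)⁻¹ * ‖g‖ ^ 2 * ‖f‖ ^ 2 := by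
  have h := integral_latticeSpectrogram_mul_char hA g f 0
  have h0 : adjointPoint A 0 = 0 := by
    have : intVec (0 : Idx d → ℤ) = 0 := by funext i; simp [intVec]
    rw [adjointPoint, this, Matrix.mulVec_zero, Matrix.mulVec_zero, neg_zero]
  simp only [h0, tfShift_zero, Pi.zero_apply, Int.cast_zero, zero_mul, Finset.sum_const_zero,
    Complex.ofReal_zero, mul_zero, Complex.exp_zero, mul_one,
    inner_self_eq_norm_sq_to_K] at h
  have h' : (∫ y, latticeSpectrogram A g f y) = (vol A)⁻¹ * (‖f‖ ^ 2 * ‖g‖ ^ 2) := by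
    refine Complex.ofReal_injective ((integral_complex_ofReal).symm.trans (h.trans ?_))
    push_cast
    rfl
  rw [h']; ring

theorem tsum_ofReal_eq_ofReal_iff {ι : Type*} {u : ι → ℝ} (hu : ∀ i, 0 ≤ u i) {b : ℝ}
    (hb : 0 ≤ b) : ∑' i, ENNReal.ofReal (u i) = ENNReal.ofReal b ↔
      Summable u ∧ b ≤ ∑' i, u i ∧ ∑' i, u i ≤ b := by
  constructor
  · intro h
    have hs : Summable u := by
      have := ENNReal.summable_toReal (h ▸ ENNReal.ofReal_ne_top)
      simpa only [ENNReal.toReal_ofReal (hu _)] using this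
    rw [← ENNReal.ofReal_tsum_of_nonneg hu hs,
      ENNReal.ofReal_eq_ofReal_iff (tsum_nonneg hu) hb] at h
    exact ⟨hs, h.ge, h.le⟩
  · rintro ⟨hs, h1, h2⟩
    rw [← ENNReal.ofReal_tsum_of_nonneg hu hs, le_antisymm h2 h1]

/-- Coordinates on the lattice. -/
noncomputable def latticeEquiv (hA : A.det ≠ 0) : (Idx d → ℤ) ≃ lattice A :=
  Equiv.ofInjective (fun k : Idx d → ℤ => A *ᵥ intVec k)
    ((Matrix.mulVec_injective_iff_isUnit.2 ((Matrix.isUnit_iff_isUnit_det A).2 hA.isUnit)).comp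
      intVec_injective)

/-- Equality in `ℝ≥0∞` with a finite value encodes both the convergence of the series and the two
frame inequalities. -/
theorem isTightFrameWith_iff (hA : A.det ≠ 0) (g : L2 d) (a : ℝ) :
    IsTightFrameWith (system g (lattice A)) a ↔
      0 < a ∧ ∀ f : L2 d, frameSum A g f = ENNReal.ofReal (a * ‖f‖ ^ 2) := by
  have hsum : ∀ f : L2 d, frameSum A g f
      = ∑' l : lattice A, ENNReal.ofReal (‖inner ℂ (system g (lattice A) l) f‖ ^ 2) := fun f =>
    (latticeEquiv hA).tsum_eq
      fun l => ENNReal.ofReal (‖inner ℂ (system g (lattice A) l) f‖ ^ 2)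
  constructor
  · rintro ⟨ha, _, h⟩
    refine ⟨ha, fun f => ?_⟩
    rw [hsum, tsum_ofReal_eq_ofReal_iff (fun _ => sq_nonneg _) (by positivity)]
    exact h f
  · rintro ⟨ha, h⟩
    refine ⟨ha, ha, fun f => ?_⟩
    rw [← tsum_ofReal_eq_ofReal_iff (fun _ => sq_nonneg _) (by positivity), ← hsum]
    exact h f

theorem isOrthogonalSystem_iff (hA : A.det ≠ 0) (g : L2 d) :
    IsOrthogonalSystem (system g (adjointLattice A)) ↔
      ∀ k : Idx d → ℤ, k ≠ 0 → inner ℂ (tfShift (adjointPoint A k) g) g = 0 := by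
  constructor
  · intro h k hk
    have h0 : (0 : PhaseSpace d) ∈ adjointLattice A := by
      refine ⟨0, ⟨0, ?_⟩, Matrix.mulVec_zero _⟩
      simp only [Pi.zero_apply, Int.cast_zero]
      exact Matrix.mulVec_zero _
    have := h ⟨_, adjointPoint_mem k⟩ ⟨0, h0⟩ fun e =>
      adjointPoint_ne_zero hA hk (congrArg Subtype.val e)
    simpa only [system, tfShift_zero] using this
  · rintro h ⟨_, _, ⟨k, rfl⟩, rfl⟩ ⟨_, _, ⟨l, rfl⟩, rfl⟩ hkl
    have hne : k - l ≠ 0 := fun e => hkl (by rw [sub_eq_zero.1 e])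
    -- Up to a phase the inner product depends only on the difference of the two points, which lies
    -- again in the adjoint lattice.
    rw [← norm_eq_zero, system, system, norm_inner_tfShift_tfShift]
    have e : sympl d *ᵥ ((Aᵀ)⁻¹ *ᵥ fun i => (l i : ℝ)) - sympl d *ᵥ ((Aᵀ)⁻¹ *ᵥ fun i => (k i : ℝ))
        = adjointPoint A (k - l) := by
      rw [adjointPoint, intVec_sub, Matrix.mulVec_sub, Matrix.mulVec_sub, neg_sub]
      rfl
    rw [e, norm_inner_symm, norm_eq_zero]
    exact h _ hne

theorem isOrthogonalSystem_of_isTightFrameWith {g : L2 d} (hg : g ≠ 0) (hA : A.det ≠ 0) {a : ℝ}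
    (h : IsTightFrameWith (system g (lattice A)) a) :
    IsOrthogonalSystem (system g (adjointLattice A)) := by
  have : Nontrivial (L2 d) := ⟨g, 0, hg⟩
  obtain ⟨_, h⟩ := (isTightFrameWith_iff hA g a).1 h
  refine (isOrthogonalSystem_iff hA g).2 fun k hk => ?_
  obtain ⟨f, hf⟩ := exists_inner_tfShift_ne_zero (adjointPoint A k)
  have h1 := integral_mul_char_eq_zero_of_periodization_eq
    (continuous_latticeSpectrogram g f).measurable (latticeSpectrogram_nonneg g f)
    (fun y => by rw [periodization_latticeSpectrogram, h, norm_tfShift]) hk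
  rw [integral_latticeSpectrogram_mul_char hA] at h1
  have hv : (((vol A)⁻¹ : ℝ) : ℂ) ≠ 0 :=
    Complex.ofReal_ne_zero.2 (inv_ne_zero (abs_ne_zero.2 hA))
  exact (mul_eq_zero.1 ((mul_eq_zero.1 h1).resolve_left hv)).resolve_left hf

/-- The mean of the constant periodization is the total integral of the spectrogram; with `f = g`
the factor `‖g‖²` cancels. -/
theorem frameBound_eq {g : L2 d} (hg : g ≠ 0) (hA : A.det ≠ 0) {a : ℝ}
    (h : IsTightFrameWith (system g (lattice A)) a) : a = (vol A)⁻¹ * ‖g‖ ^ 2 := by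
  obtain ⟨ha, h⟩ := (isTightFrameWith_iff hA g a).1 h
  have hgp : 0 < ‖g‖ ^ 2 := by have := norm_pos_iff.2 hg; positivity
  have h1 := lintegral_eq_of_periodization_eq
    (continuous_latticeSpectrogram (A := A) g g).measurable.ennreal_ofReal
    (fun y => by rw [periodization_latticeSpectrogram, h, norm_tfShift])
  rw [← ofReal_integral_eq_lintegral_ofReal (integrable_latticeSpectrogram hA g g)
    (.of_forall (latticeSpectrogram_nonneg g g)), integral_latticeSpectrogram hA,
    ENNReal.ofReal_eq_ofReal_iff (by unfold vol; positivity) (by positivity)] at h1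
  exact (mul_right_cancel₀ hgp.ne' h1).symm

theorem norm_add_sq_le {u v : ℂ} {ε : ℝ} (hε : 0 < ε) :
    ‖u + v‖ ^ 2 ≤ (1 + ε) * ‖u‖ ^ 2 + (1 + ε⁻¹) * ‖v‖ ^ 2 := by
  have h1 : ‖u + v‖ ^ 2 ≤ (‖u‖ + ‖v‖) ^ 2 := by gcongr; exact norm_add_le u v
  have h2 : 2 * (‖u‖ * ‖v‖) ≤ ε * ‖u‖ ^ 2 + ε⁻¹ * ‖v‖ ^ 2 := by
    have : 0 ≤ ε⁻¹ * (ε * ‖u‖ - ‖v‖) ^ 2 := by positivity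
    have e : ε⁻¹ * (ε * ‖u‖ - ‖v‖) ^ 2
        = ε * ‖u‖ ^ 2 + ε⁻¹ * ‖v‖ ^ 2 - 2 * (‖u‖ * ‖v‖) := by
      field_simp; ring
    linarith
  nlinarith

theorem frameSum_add_le (g f h : L2 d) {ε : ℝ} (hε : 0 < ε) :
    frameSum A g (f + h) ≤ ENNReal.ofReal (1 + ε) * frameSum A g f
      + ENNReal.ofReal (1 + ε⁻¹) * frameSum A g h := by
  simp only [frameSum]
  rw [← ENNReal.tsum_mul_left, ← ENNReal.tsum_mul_left, ← ENNReal.tsum_add]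
  refine ENNReal.tsum_le_tsum fun k => ?_
  rw [← ENNReal.ofReal_mul (by positivity), ← ENNReal.ofReal_mul (by positivity),
    ← ENNReal.ofReal_add (by positivity) (by positivity), inner_add_right]
  exact ENNReal.ofReal_le_ofReal (norm_add_sq_le hε)

theorem dense_frameSum_tfShift_eq {g : L2 d} (hA : A.det ≠ 0)
    (h : IsOrthogonalSystem (system g (adjointLattice A))) (f : L2 d) :
    Dense {y | frameSum A g (tfShift (-(A *ᵥ y)) f)
      = ENNReal.ofReal ((vol A)⁻¹ * ‖g‖ ^ 2 * ‖f‖ ^ 2)} := by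
  have := dense_periodization_eq (continuous_latticeSpectrogram g f).measurable
    (integrable_latticeSpectrogram hA g f) (latticeSpectrogram_nonneg g f) fun k hk => by
      rw [integral_latticeSpectrogram_mul_char hA, (isOrthogonalSystem_iff hA g).1 h k hk,
        mul_zero, mul_zero]
  simpa only [periodization_latticeSpectrogram, integral_latticeSpectrogram hA] using this

/-- Each finite partial sum is continuous in `y` and bounded by the constant on a dense set, hence
also at `y = 0`. Taking the supremum preserves only this inequality. -/
theorem frameSum_le {g : L2 d} (hA : A.det ≠ 0)
    (h : IsOrthogonalSystem (system g (adjointLattice A))) (f : L2 d) :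
    frameSum A g f ≤ ENNReal.ofReal ((vol A)⁻¹ * ‖g‖ ^ 2 * ‖f‖ ^ 2) := by
  rw [frameSum, ENNReal.tsum_eq_iSup_sum]
  refine iSup_le fun s => ?_
  let T : PhaseSpace d → ℝ≥0∞ := fun y =>
    ∑ k ∈ s, ENNReal.ofReal (latticeSpectrogram A g f (y + intVec k))
  have hT : Continuous T := continuous_finsetSum _ fun k _ => ENNReal.continuous_ofReal.comp
    ((continuous_latticeSpectrogram g f).comp (continuous_add_const _))
  have hcl : IsClosed {y | T y ≤ ENNReal.ofReal ((vol A)⁻¹ * ‖g‖ ^ 2 * ‖f‖ ^ 2)} :=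
    isClosed_le hT continuous_const
  have hsub : closure {y | frameSum A g (tfShift (-(A *ᵥ y)) f)
      = ENNReal.ofReal ((vol A)⁻¹ * ‖g‖ ^ 2 * ‖f‖ ^ 2)} ⊆ _ :=
    closure_minimal (fun y hy => by
      rw [Set.mem_ofPred_eq, ← hy, ← periodization_latticeSpectrogram]
      exact ENNReal.sum_le_tsum s) hcl
  rw [(dense_frameSum_tfShift_eq hA h f).closure_eq] at hsub
  have h0 : T 0 ≤ _ := hsub (Set.mem_univ 0)
  simpa only [T, zero_add, latticeSpectrogram] using! h0

/-- Along points `y → 0` of the dense set, compare `π(-Ay)f` with `f`: the frame sum of the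
difference is at most `c‖π(-Ay)f - f‖²` by the upper bound already proved, and this tends to zero.
-/
theorem le_frameSum {g : L2 d} (hA : A.det ≠ 0)
    (h : IsOrthogonalSystem (system g (adjointLattice A))) (f : L2 d) :
    ENNReal.ofReal ((vol A)⁻¹ * ‖g‖ ^ 2 * ‖f‖ ^ 2) ≤ frameSum A g f := by
  set c := (vol A)⁻¹ * ‖g‖ ^ 2 with hc
  have hc0 : 0 ≤ c := by rw [hc, vol]; positivity
  have hfin : frameSum A g f ≠ ⊤ := ((frameSum_le hA h f).trans_lt ENNReal.ofReal_lt_top).ne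
  obtain ⟨S, hS0, hS⟩ : ∃ S : ℝ, 0 ≤ S ∧ frameSum A g f = ENNReal.ofReal S :=
    ⟨_, ENNReal.toReal_nonneg, (ENNReal.ofReal_toReal hfin).symm⟩
  rw [hS]
  refine ENNReal.ofReal_le_ofReal ?_
  have hε : ∀ ε : ℝ, 0 < ε → c * ‖f‖ ^ 2 ≤ (1 + ε) * S := by
    intro ε hε
    let D := {y | frameSum A g (tfShift (-(A *ᵥ y)) f) = ENNReal.ofReal (c * ‖f‖ ^ 2)}
    have hD : Dense D := dense_frameSum_tfShift_eq hA h f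
    have : (𝓝[D] (0 : PhaseSpace d)).NeBot := mem_closure_iff_nhdsWithin_neBot.1 (hD 0)
    have hlim : Filter.Tendsto (fun y : PhaseSpace d => (1 + ε) * S
        + (1 + ε⁻¹) * (c * ‖tfShift (-(A *ᵥ y)) f - f‖ ^ 2)) (𝓝[D] 0) (𝓝 ((1 + ε) * S)) := by
      have h1 : Filter.Tendsto (fun y : PhaseSpace d => -(A *ᵥ y)) (𝓝[D] 0) (𝓝 0) := by
        have : Continuous fun y : PhaseSpace d => -(A *ᵥ y) := continuous_mulVec.neg
        simpa using (this.tendsto 0).mono_left nhdsWithin_le_nhds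
      have h2 := (((tendsto_iff_norm_sub_tendsto_zero.1
        ((continuous_tfShift_at_zero f).comp h1)).pow 2).const_mul c).const_mul (1 + ε⁻¹)
      simpa using h2.const_add ((1 + ε) * S)
    refine ge_of_tendsto hlim ?_
    filter_upwards [self_mem_nhdsWithin] with y hy
    have h1 := frameSum_add_le (A := A) g f (tfShift (-(A *ᵥ y)) f - f) hε
    rw [add_sub_cancel, show frameSum A g (tfShift (-(A *ᵥ y)) f) = _ from hy, hS] at h1
    have h2 := h1.trans (add_le_add_right (mul_le_mul_right (frameSum_le hA h _) _) _)
    rw [← ENNReal.ofReal_mul (by positivity), ← ENNReal.ofReal_mul (by positivity),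
      ← ENNReal.ofReal_add (by positivity) (by positivity)] at h2
    exact (ENNReal.ofReal_le_ofReal_iff (by positivity)).1 h2
  -- The choice `ε = δ / (S + 1)` gives `εS ≤ δ` and is also meaningful when `S = 0`.
  refine le_of_forall_pos_le_add fun δ hδ => (hε (δ / (S + 1)) (by positivity)).trans ?_
  have : δ / (S + 1) * S ≤ δ := by
    rw [div_mul_eq_mul_div, div_le_iff₀ (by positivity)]
    nlinarith
  linarith

theorem isTightFrameWith_of_isOrthogonalSystem {g : L2 d} (hg : g ≠ 0) (hA : A.det ≠ 0)
    (h : IsOrthogonalSystem (system g (adjointLattice A))) :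
    IsTightFrameWith (system g (lattice A)) ((vol A)⁻¹ * ‖g‖ ^ 2) := by
  refine (isTightFrameWith_iff hA g _).2 ⟨?_, fun f =>
    le_antisymm (frameSum_le hA h f) (le_frameSum hA h f)⟩
  have h1 := norm_pos_iff.2 hg
  have h2 : 0 < vol A := abs_pos.2 hA
  positivity

end Duality

end Gabor

theorem mainTheorem12 (d : ℕ) (g : Gabor.L2 d) (hg : g ≠ 0)
    (A : Matrix (Gabor.Idx d) (Gabor.Idx d) ℝ) (hA : IsUnit A.det) :
    (Gabor.IsTightFrame (Gabor.system g (Gabor.lattice A)) ↔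
      Gabor.IsOrthogonalSystem (Gabor.system g (Gabor.adjointLattice A))) ∧
    (∀ a : ℝ, Gabor.IsTightFrameWith (Gabor.system g (Gabor.lattice A)) a →
      a = (Gabor.vol A)⁻¹ * ‖g‖ ^ 2) :=
  ⟨⟨fun ⟨_, h⟩ => Gabor.isOrthogonalSystem_of_isTightFrameWith hg hA.ne_zero h,
    fun h => ⟨_, Gabor.isTightFrameWith_of_isOrthogonalSystem hg hA.ne_zero h⟩⟩,
    fun _ h => Gabor.frameBound_eq hg hA.ne_zero h⟩
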